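/- Let $(R,\mathfrak m,k)$ be a commutative Noetherian local ring that is not a field, and let $S=R\ltimes k$ be the idealization of its residue field, i.e. the commutative ring with additive group $R\oplus k$ and multiplication $(r_1,a_1)(r_2,a_2)=(r_1r_2,\,r_1a_2+r_2a_1)$. Let $M$ be a finitely generated $S$-module. Then $M$ is reflexive (that is, the canonical map $M\to M^{**}$ with $(-)^*=\operatorname{Hom}_S(-,S)$ is an isomorphism) and $\operatorname{Ext}^1_S(M,S)=0$ if and only if $M$ is a free $S$-module. -/

import Mathlib

open IsLocalRing

universe u

/-- The right action of `R` on its residue field, equal to the left action: `a • r = r • a`. -/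
noncomputable instance residueFieldModuleOp (R : Type*) [CommRing R] [IsLocalRing R] :
    Module Rᵐᵒᵖ (ResidueField R) :=
  Module.compHom (ResidueField R) ((RingHom.id R).fromOpposite fun x y => Commute.all x y)

instance residueFieldIsCentralScalar (R : Type*) [CommRing R] [IsLocalRing R] :
    IsCentralScalar R (ResidueField R) :=
  ⟨fun _ _ => rfl⟩

/-- The idealization `R ⋉ k` of the residue field `k` of a local ring `R`: the abelian group
`R × k` with the product `(r₁, a₁) * (r₂, a₂) = (r₁ * r₂, r₁ • a₂ + r₂ • a₁)`. -/
abbrev IdealizationResidueField (R : Type*) [CommRing R] [IsLocalRing R] : Type _ :=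
  TrivSqZeroExt R (ResidueField R)

/-! Let `𝔫 = 𝔪 ⊕ k` be the maximal ideal of `S`; the projection `π : 𝔫 → k ⊆ S` is `S`-linear. If
`M` is not free, some `x ∉ 𝔫M` has all its values `f x` in `𝔫`, so `f ↦ π (f x)` lies in `M**`. By
reflexivity it is evaluation at some `y`, and `y` spans a direct summand `k` of `M`
(`exists_retract_residueField_of_isReflexive`). Then `Ext¹(k, S) = 0`, which forces `𝔪 = 0`
(`isField_of_subsingleton_ext_residueField`). -/

open CategoryTheory Abelian TensorProduct

section Local

variable {S : Type u} [CommRing S] [IsLocalRing S]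

/-- Over a local ring, `1 ⊗ₜ x` vanishes in `k ⊗ M` exactly when `x ∈ 𝔪 M`. -/
lemma one_tmul_residueField_eq_zero_iff {M : Type*} [AddCommGroup M] [Module S M] (x : M) :
    (1 : ResidueField S) ⊗ₜ[S] x = 0 ↔ x ∈ maximalIdeal S • (⊤ : Submodule S M) := by
  have h := quotTensorEquivQuotSMul_mk_tmul (M := M) (maximalIdeal S) 1 x
  rw [one_smul, map_one] at h
  rw [← Submodule.Quotient.mk_eq_zero, ← h]
  exact (LinearEquiv.map_eq_zero_iff _).symm

/-- A finite module over a Noetherian local ring is free if each element whose image under every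
linear form is a nonunit lies in `𝔪 M`. -/
lemma free_of_forall_dual_mem_maximalIdeal [IsNoetherianRing S] {M : Type*} [AddCommGroup M]
    [Module S M] [Module.Finite S M]
    (h : ∀ x : M, (∀ f : Module.Dual S M, f x ∈ maximalIdeal S) →
      x ∈ maximalIdeal S • (⊤ : Submodule S M)) :
    Module.Free S M := by
  have : Module.Finite S (Module.Dual S M) := by
    obtain ⟨n, p, hp⟩ := Module.Finite.exists_fin' S M
    exact Module.Finite.of_injective (LinearMap.lcomp S S p)
      (LinearMap.lcomp_injective_of_surjective p hp)
  obtain ⟨n, f, hf⟩ := Module.Finite.exists_fin (R := S) (M := Module.Dual S M)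
  let l : M →ₗ[S] (Fin n → S) := LinearMap.pi f
  -- A map to a free module that is injective modulo the maximal ideal splits, so `M` is a summand
  -- of `S^n`.
  have hl : Function.Injective (l.lTensor (ResidueField S)) := by
    rw [injective_iff_map_eq_zero]
    intro t ht
    obtain ⟨x, rfl⟩ := TensorProduct.mk_surjective S M (ResidueField S) residue_surjective t
    rw [TensorProduct.mk_apply] at ht ⊢
    rw [LinearMap.lTensor_tmul, one_tmul_residueField_eq_zero_iff] at ht
    rw [one_tmul_residueField_eq_zero_iff]
    refine h x fun g => ?_
    have hg : g ∈ Submodule.span S (Set.range f) := hf ▸ Submodule.mem_top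
    have hle : Submodule.span S (Set.range f) ≤
        Submodule.comap (Module.Dual.eval S M x) (maximalIdeal S) := by
      rw [Submodule.span_le]
      rintro _ ⟨i, rfl⟩
      have hi : maximalIdeal S • (⊤ : Submodule S (Fin n → S)) ≤
          Submodule.comap (LinearMap.proj i) (maximalIdeal S) :=
        Submodule.smul_le.mpr fun r hr v _ => Ideal.mul_mem_right (v i) _ hr
      exact hi ht
    exact hle hg
  obtain ⟨s, hs⟩ := (split_injective_iff_lTensor_residueField_injective l).mpr hl
  have := Module.Projective.of_split l s hs
  exact Module.free_of_flat_of_isLocalRing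

/-- If `Ext¹(S ⧸ I, N)` vanishes, every linear map `I → N` extends to `S`. -/
lemma exists_extend_of_subsingleton_ext_quotient {S : Type u} [CommRing S] (I : Ideal S)
    (N : Type u) [AddCommGroup N] [Module S N]
    [Subsingleton (Ext (ModuleCat.of S (S ⧸ I)) (ModuleCat.of S N) 1)] (g : I →ₗ[S] N) :
    ∃ G : S →ₗ[S] N, ∀ x : I, G x = g x := by
  let T : ShortComplex (ModuleCat.{u} S) :=
    ShortComplex.mk (ModuleCat.ofHom I.subtype) (ModuleCat.ofHom (Submodule.mkQ I)) (by
      ext x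
      exact Ideal.Quotient.eq_zero_iff_mem.mpr x.2)
  have hT : T.ShortExact :=
    { exact := (ShortComplex.ShortExact.moduleCat_exact_iff_function_exact T).mpr
        (LinearMap.exact_subtype_mkQ I)
      mono_f := (ModuleCat.mono_iff_injective _).mpr I.injective_subtype
      epi_g := (ModuleCat.epi_iff_surjective _).mpr (Submodule.mkQ_surjective I) }
  have : Subsingleton (Ext T.X₃ (ModuleCat.of S N) 1) := ‹_›
  obtain ⟨y, hy⟩ := Ext.contravariant_sequence_exact₁ hT (ModuleCat.of S N)
    (Ext.mk₀ (ModuleCat.ofHom g)) (add_zero 1) (Subsingleton.elim _ _)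
  obtain ⟨G, rfl⟩ := (Ext.mk₀_bijective _ _).2 y
  rw [Ext.mk₀_comp_mk₀] at hy
  have hG := (Ext.mk₀_bijective _ _).1 hy
  exact ⟨G.hom, fun x => congrArg (fun f => f.hom x) hG⟩

/-- Vanishing of `Ext` in the first argument passes to retracts. -/
lemma subsingleton_ext_of_retract {C : Type*} [Category C] [Abelian C] [HasExt C] {X Y Z : C}
    (r : Retract X Y) (n : ℕ) [Subsingleton (Ext Y Z n)] : Subsingleton (Ext X Z n) := by
  refine subsingleton_of_forall_eq 0 fun x => ?_
  have h : (Ext.mk₀ r.r).comp x (zero_add n) = 0 := Subsingleton.elim _ _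
  rw [← Ext.mk₀_id_comp x, ← r.retract, ← Ext.mk₀_comp_mk₀_assoc, h, Ext.comp_zero]

end Local

section Idealization

open TrivSqZeroExt

variable (R : Type u) [CommRing R] [IsLocalRing R]

local notation "S" => IdealizationResidueField R

instance : IsLocalRing S :=
  .of_nonunits_add fun a b ha hb => by
    rw [mem_nonunits_iff, isUnit_iff_isUnit_fst] at *
    exact IsLocalRing.nonunits_add ha hb

instance [IsNoetherianRing R] : IsNoetherianRing S := by
  have : Module.Finite R (ResidueField R) := inferInstance
  have : IsNoetherian R (R × ResidueField R) := inferInstance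
  have : IsNoetherian R S := this
  exact isNoetherian_of_tower R this

variable {R}

lemma mem_maximalIdeal_idealization_iff {x : S} :
    x ∈ maximalIdeal S ↔ x.fst ∈ maximalIdeal R := by
  rw [mem_maximalIdeal, mem_maximalIdeal, mem_nonunits_iff, mem_nonunits_iff,
    isUnit_iff_isUnit_fst]

lemma smul_residueField_eq_zero {r : R} (hr : r ∈ maximalIdeal R) (a : ResidueField R) :
    r • a = 0 := by
  rw [Algebra.smul_def, ResidueField.algebraMap_eq, (residue_eq_zero_iff r).mpr hr, zero_mul]

variable (R) in
/-- The projection of the maximal ideal `𝔪 ⊕ k` of `R ⋉ k` onto its summand `k`. -/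
noncomputable def maximalIdealProjInr : maximalIdeal S →ₗ[S] S where
  toFun x := inr (x : S).snd
  map_add' x y := by simp
  map_smul' s x := by
    -- The cross term `x.fst • s.snd` dies because `x.fst ∈ 𝔪`; on all of `S` the projection is not
    -- linear.
    have hx := mem_maximalIdeal_idealization_iff.mp x.2
    ext <;> simp [smul_residueField_eq_zero hx]

variable (R) in
/-- The embedding of the residue field of `R ⋉ k` as the summand `k` of the maximal ideal. -/
noncomputable def residueFieldToInr : (S ⧸ maximalIdeal S) →ₗ[S] S :=
  (maximalIdeal S).liftQ (LinearMap.toSpanSingleton S S (inr 1)) fun x hx => by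
    have hx := mem_maximalIdeal_idealization_iff.mp hx
    ext <;> simp [smul_residueField_eq_zero hx]

lemma residueFieldToInr_one : residueFieldToInr R 1 = inr 1 := by
  change LinearMap.toSpanSingleton S S (inr 1) 1 = inr 1
  simp

lemma residueFieldToInr_injective : Function.Injective (residueFieldToInr R) := by
  rw [injective_iff_map_eq_zero]
  intro a ha
  obtain ⟨x, rfl⟩ := Ideal.Quotient.mk_surjective a
  have hx : x * inr 1 = 0 := ha
  have h2 := congrArg snd hx
  rw [Ideal.Quotient.eq_zero_iff_mem, mem_maximalIdeal_idealization_iff, ← residue_eq_zero_iff]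
  simpa [Algebra.smul_def] using h2

/-- An extension of `π` to `S` is multiplication by `c = G 1`. It fixes `inr 1`, so `c` is a unit,
yet it kills `inl r` for `r ∈ 𝔪`. -/
lemma isField_of_subsingleton_ext_residueField
    [Subsingleton (Ext (ModuleCat.of S (S ⧸ maximalIdeal S)) (ModuleCat.of S S) 1)] :
    IsField R := by
  obtain ⟨G, hG⟩ := exists_extend_of_subsingleton_ext_quotient (maximalIdeal S) S
    (maximalIdealProjInr R)
  have hmul (x : S) (hx : x.fst ∈ maximalIdeal R) : x * G 1 = inr x.snd := by
    rw [← smul_eq_mul, ← map_smul, smul_eq_mul, mul_one]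
    exact hG ⟨x, mem_maximalIdeal_idealization_iff.mpr hx⟩
  have hunit : IsUnit (G 1).fst := by
    have h := congrArg snd (hmul (inr 1) (by simp))
    by_contra hn
    simp [smul_residueField_eq_zero ((mem_maximalIdeal _).mpr hn)] at h
  rw [isField_iff_maximalIdeal_eq, eq_bot_iff]
  intro r hr
  have h := congrArg fst (hmul (inl r) (by simpa using hr))
  simpa [hunit.mul_left_eq_zero] using h

/-- Over `R ⋉ k`, a reflexive module having an element outside `𝔪 M` on which all linear forms
take nonunit values has the residue field as a direct summand. -/
lemma exists_retract_residueField_of_isReflexive {M : Type*} [AddCommGroup M] [Module S M]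
    [Module.IsReflexive S M] {x : M} (hx : x ∉ maximalIdeal S • (⊤ : Submodule S M))
    (hf : ∀ f : Module.Dual S M, f x ∈ maximalIdeal S) :
    ∃ (i : (S ⧸ maximalIdeal S) →ₗ[S] M) (s : M →ₗ[S] (S ⧸ maximalIdeal S)),
      s ∘ₗ i = LinearMap.id := by
  obtain ⟨φ, hφ⟩ : ∃ φ : M →ₗ[S] (S ⧸ maximalIdeal S), φ x = 1 := by
    have hv : (1 : ResidueField S) ⊗ₜ[S] x ≠ 0 :=
      (one_tmul_residueField_eq_zero_iff x).not.mpr hx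
    obtain ⟨ψ, hψ⟩ := Module.Projective.exists_dual_eq_one (ResidueField S) hv
    exact ⟨ψ.restrictScalars S ∘ₗ TensorProduct.mk S (ResidueField S) M 1, hψ⟩
  let Ψ : Module.Dual S (Module.Dual S M) :=
    maximalIdealProjInr R ∘ₗ (Module.Dual.eval S M x).codRestrict (maximalIdeal S) hf
  obtain ⟨y, hy⟩ := (Module.bijective_dual_eval S M).2 Ψ
  have hy (f : Module.Dual S M) : f y = inr (f x).snd := LinearMap.congr_fun hy f
  -- Every `f y` lies in the summand `k`, which the maximal ideal kills, and linear forms separate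
  -- points of `M`.
  have hys (s : S) (hs : s ∈ maximalIdeal S) : s • y = 0 := by
    have hs := mem_maximalIdeal_idealization_iff.mp hs
    apply (Module.bijective_dual_eval S M).1
    ext1 f
    rw [map_zero, LinearMap.zero_apply, Module.Dual.eval_apply, map_smul, hy]
    ext <;> simp [smul_residueField_eq_zero hs]
  -- Embedding `k` in `S` turns `φ` into a linear form, to which `hy` applies.
  have hφy : φ y = 1 := by
    apply residueFieldToInr_injective
    have h := hy (residueFieldToInr R ∘ₗ φ)
    simpa [hφ, residueFieldToInr_one] using h
  refine ⟨(maximalIdeal S).liftQ (LinearMap.toSpanSingleton S M y)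
    fun s hs => by simpa using hys s hs, φ, ?_⟩
  refine Submodule.linearMap_qext _ (LinearMap.ext_ring ?_)
  change φ (LinearMap.toSpanSingleton S M y 1) = 1
  rw [LinearMap.toSpanSingleton_apply, one_smul, hφy]

end Idealization

theorem proposition3p8 {R : Type u} [CommRing R] [IsLocalRing R] [IsNoetherianRing R]
    (hR : ¬ IsField R)
    (M : Type u) [AddCommGroup M] [Module (IdealizationResidueField R) M]
    [Module.Finite (IdealizationResidueField R) M] :
    (Module.IsReflexive (IdealizationResidueField R) M ∧
      Subsingleton (CategoryTheory.Abelian.Ext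
        (ModuleCat.of (IdealizationResidueField R) M)
        (ModuleCat.of (IdealizationResidueField R) (IdealizationResidueField R)) 1)) ↔
    Module.Free (IdealizationResidueField R) M := by

  constructor
  · rintro ⟨_, _⟩
    refine free_of_forall_dual_mem_maximalIdeal fun x hf => ?_
    by_contra hx
    obtain ⟨i, s, hs⟩ := exists_retract_residueField_of_isReflexive hx hf
    have := subsingleton_ext_of_retract (Z := ModuleCat.of (IdealizationResidueField R)
      (IdealizationResidueField R)) (n := 1)
      { i := ModuleCat.ofHom i, r := ModuleCat.ofHom s, retract := by
          rw [← ModuleCat.ofHom_comp, hs, ModuleCat.ofHom_id] : Retract (ModuleCat.of _ _)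
            (ModuleCat.of _ M) }
    exact hR isField_of_subsingleton_ext_residueField
  · intro _
    have : Projective (ModuleCat.of (IdealizationResidueField R) M) :=
      (IsProjective.iff_projective _).mp inferInstance
    exact ⟨inferInstance, Ext.subsingleton_of_projective _ _ 0⟩
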